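/- Let $X$, $B$, $Y$ be Banach spaces such that the embedding $X\hookrightarrow B$ is compact and the embedding $B\hookrightarrow Y$ is continuous. Let $1\le p\le\infty$, $0<\alpha<1$ and $T>0$. Define $(\lambda_k)_{k\ge1}$ by $$\lambda_1=1,\qquad \lambda_{k+1}=\sum_{j=1}^{k}\big((k-j+1)^{\alpha-1}-(k-j+2)^{\alpha-1}\big)\lambda_j\quad(k\ge1).$$ Consider a family of piecewise constant functions $$f^{(\tau)}=f_0\,\chi_{\{0\}}+\sum_{k=1}^{N}f_k\,\chi_{(t_{k-1},t_k]}\quad\text{on }[0,T],\qquad t_k=k\tau,\quad \tau=T/N,\quad N\in\{1,2,\dots\},$$ where $f_k=f_k^{(\tau)}\in X$ for $1\le k\le N$, the initial value $f_0=f_0^{(\tau)}$ lies in $Y$ (for instance in $X$), and $N$ and the values depend on the member of the family. The discrete Caputo derivative of $f^{(\tau)}$ is the $Y$-valued function $$D^\alpha_\tau f^{(\tau)}=\sum_{k=1}^{N}(D^\alpha_\tau f)_k\,\chi_{(t_{k-1},t_k]},\qquad (D^\alpha_\tau f)_k=\Gamma(\alpha)\,\tau^{-\alpha}\sum_{j=0}^{k-1}\lambda_{k-j}\,(f_{j+1}-f_j).$$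 Suppose there is a constant $C_0$, the same for all members of the family, with $$\|f^{(\tau)}\|_{L^p(0,T;X)}+\|D^\alpha_\tau f^{(\tau)}\|_{L^p(0,T;Y)}\le C_0 .$$ Then $\{f^{(\tau)}\}$ is relatively compact in $L^p(0,T;B)$. -/

import Mathlib

open MeasureTheory Set
open scoped ENNReal

noncomputable section

/-- The weights `λ_k`, `k ≥ 1`, of the discrete Caputo derivative of order `α`:
`λ_1 = 1` and `λ_{k+1} = ∑_{j=1}^k ((k-j+1)^{α-1} - (k-j+2)^{α-1}) λ_j` for `k ≥ 1`
(see `caputoWeight_succ`). The index `0` is never used; its value is set to `0`. -/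
def caputoWeight (α : ℝ) : ℕ → ℝ
  | 0 => 0
  | 1 => 1
  | k + 2 => ∑ j : Fin (k + 1),
      (((k : ℝ) - (j : ℕ) + 1) ^ (α - 1) - ((k : ℝ) - (j : ℕ) + 2) ^ (α - 1)) *
        caputoWeight α ((j : ℕ) + 1)
  decreasing_by
    have := j.isLt
    omega

theorem caputoWeight_one (α : ℝ) : caputoWeight α 1 = 1 := by
  rw [caputoWeight]

theorem caputoWeight_succ (α : ℝ) (k : ℕ) (hk : 1 ≤ k) :
    caputoWeight α (k + 1) = ∑ j ∈ Finset.Icc 1 k,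
      (((k : ℝ) - j + 1) ^ (α - 1) - ((k : ℝ) - j + 2) ^ (α - 1)) * caputoWeight α j := by
  obtain ⟨m, rfl⟩ : ∃ m, k = m + 1 := ⟨k - 1, by omega⟩
  rw [caputoWeight, Finset.sum_fin_eq_sum_range, ← Finset.Ico_add_one_right_eq_Icc,
    Finset.sum_Ico_eq_sum_range]
  apply Finset.sum_congr rfl
  intro j hj
  rw [dif_pos (Finset.mem_range.mp hj), add_comm 1 j]
  push_cast
  congr 3 <;> ring

/-- The discrete (left) Caputo derivative of order `α` with step `τ` of the sequence
`f_0, f_1, f_2, …`, at the `k`-th node: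
`Γ(α) τ^{-α} ∑_{j=0}^{k-1} λ_{k-j} (f_{j+1} - f_j)`. -/
def discreteCaputo {E : Type*} [NormedAddCommGroup E] [NormedSpace ℝ E]
    (α τ : ℝ) (f : ℕ → E) (k : ℕ) : E :=
  (Real.Gamma α * τ ^ (-α)) •
    ∑ j ∈ Finset.range k, caputoWeight α (k - j) • (f (j + 1) - f j)

/-- The piecewise constant function `∑_{k=1}^N v_k χ_{(t_{k-1}, t_k]}` with `t_k = k τ`. -/
def stepFun {E : Type*} [NormedAddCommGroup E] (τ : ℝ) (N : ℕ) (v : ℕ → E) (t : ℝ) : E :=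
  ∑ k ∈ Finset.Icc 1 N, (Ioc (((k : ℝ) - 1) * τ) ((k : ℝ) * τ)).indicator (fun _ => v k) t

/-- The sequence `y, v_1, v_2, …`: the nodal values of a piecewise constant function with
initial value `y`. -/
def withInitial {E : Type*} (y : E) (v : ℕ → E) : ℕ → E
  | 0 => y
  | k + 1 => v (k + 1)

end

/-! The discrete Caputo derivative inverts explicitly: `f n - f 0` is, up to the factor `(Γ(α)
τ^{-α})⁻¹`, the convolution of the derivative with the decreasing kernel `(i + 1) ^ (α - 1)`, whose
first `m` terms sum to at most `m ^ α / α`. Young's inequality then bounds increments over `m` steps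
in `L^p(Y)` by a constant times `(m τ) ^ α`, uniformly in the family
(`eLpNorm_discreteFracIntegral_shift_sub_le`). The initial value cancels in increments, so it needs
no bound.

Averaging over `L` equal blocks of `[0, T]` therefore moves `f` by `O(L^{-α})` in `L^p(Y)`, while
`f` minus its average stays bounded in `L^p(X)`. Ehrling's lemma turns this into smallness in
`L^p(B)`, uniformly for `N ≥ L` (`exists_gridAverage_approx`). For fixed `L` the averages are step
functions with `L` values in the image of a bounded set of `X`, hence totally bounded; the members
with `N ≤ L` live on finitely many grids and are handled in the same way. So the family is totally
bounded in the complete space `L^p(0,T;B)`. -/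

/-! ### Inversion of the discrete Caputo derivative. -/

/-- The weights `λ` are the convolution inverse of the kernel `(i + 1) ^ (α - 1)`. -/
theorem sum_rpow_mul_caputoWeight (α : ℝ) (k : ℕ) :
    ∑ i ∈ Finset.range (k + 1), ((i : ℝ) + 1) ^ (α - 1) * caputoWeight α (k + 1 - i) = 1 := by
  induction k with
  | zero => simp [caputoWeight_one]
  | succ k ih =>
    have h := caputoWeight_succ α (k + 1) (by omega)
    rw [← Finset.Ico_add_one_right_eq_Icc, Finset.sum_Ico_eq_sum_range,
      ← Finset.sum_range_reflect] at h
    rw [Finset.sum_range_succ']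
    simp only [Nat.cast_zero, zero_add, Real.one_rpow, one_mul, Nat.sub_zero]
    rw [h, show k + 1 + 1 - 1 = k + 1 by omega, ← Finset.sum_add_distrib]
    -- The recursion expands the newest weight into kernel differences; their negative parts cancel
    -- the shifted sum and leave the sum of the previous stage.
    refine Eq.trans ?_ ih
    refine Finset.sum_congr rfl fun i hi => ?_
    have hi : i ≤ k := by simpa [Nat.lt_succ_iff] using hi
    rw [show k + 1 + 1 - (i + 1) = k + 1 - i by omega,
      show 1 + (k + 1 - 1 - i) = k + 1 - i by omega, Nat.cast_sub (by omega : i ≤ k + 1)]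
    push_cast
    rw [show (k : ℝ) + 1 - (k + 1 - i) + 1 = i + 1 by ring,
      show (k : ℝ) + 1 - (k + 1 - i) + 2 = i + 1 + 1 by ring]
    ring

/-- A sequence is recovered from its discrete Caputo derivative by a discrete fractional
integral. -/
theorem sum_rpow_smul_discreteCaputo {E : Type*} [NormedAddCommGroup E] [NormedSpace ℝ E]
    (α τ : ℝ) (f : ℕ → E) (n : ℕ) :
    ∑ i ∈ Finset.range n, ((i : ℝ) + 1) ^ (α - 1) • discreteCaputo α τ f (n - i) =
      (Real.Gamma α * τ ^ (-α)) • (f n - f 0) := by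
  have hsmul : ∀ i : ℕ, ((i : ℝ) + 1) ^ (α - 1) • discreteCaputo α τ f (n - i) =
      (Real.Gamma α * τ ^ (-α)) • ∑ j ∈ Finset.range (n - i),
        (((i : ℝ) + 1) ^ (α - 1) * caputoWeight α (n - i - j)) • (f (j + 1) - f j) := by
    intro i
    rw [discreteCaputo, smul_comm, Finset.smul_sum]
    simp only [mul_smul]
  have hcomm : ∑ i ∈ Finset.range n, ∑ j ∈ Finset.range (n - i),
        (((i : ℝ) + 1) ^ (α - 1) * caputoWeight α (n - i - j)) • (f (j + 1) - f j) =
      ∑ j ∈ Finset.range n, ∑ i ∈ Finset.range (n - j),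
        (((i : ℝ) + 1) ^ (α - 1) * caputoWeight α (n - i - j)) • (f (j + 1) - f j) := by
    refine Finset.sum_comm' fun i j => ?_
    simp only [Finset.mem_range]
    omega
  rw [Finset.sum_congr rfl fun i _ => hsmul i, ← Finset.smul_sum, hcomm,
    ← Finset.sum_range_sub f n]
  congr 1
  refine Finset.sum_congr rfl fun j hj => ?_
  obtain ⟨k, hk⟩ : ∃ k, n - j = k + 1 :=
    ⟨n - j - 1, by have := Finset.mem_range.1 hj; omega⟩
  rw [← Finset.sum_smul, hk]
  have h := sum_rpow_mul_caputoWeight α k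
  rw [← hk] at h ⊢
  rw [Finset.sum_congr rfl fun i _ => by rw [Nat.sub_right_comm], h, one_smul]

/-- Concavity of `x ^ α` gives `α (m + 1) ^ (α - 1) ≤ (m + 1) ^ α - m ^ α`, and this telescopes. The
concavity enters as Bernoulli's inequality at `-1 / (m + 1)`. -/
theorem sum_range_rpow_le {α : ℝ} (hα0 : 0 < α) (hα1 : α < 1) (m : ℕ) :
    ∑ i ∈ Finset.range m, ((i : ℝ) + 1) ^ (α - 1) ≤ (m : ℝ) ^ α / α := by
  induction m with
  | zero => simp [Real.zero_rpow hα0.ne']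
  | succ m ih =>
    rw [Finset.sum_range_succ]
    refine (add_le_add_left ih _).trans ?_
    have hm : (0 : ℝ) < (m : ℝ) + 1 := by positivity
    have hB := rpow_one_add_le_one_add_mul_self (s := -(1 / ((m : ℝ) + 1))) (by
      rw [neg_le_neg_iff, div_le_one hm]; linarith [(Nat.cast_nonneg m : (0 : ℝ) ≤ m)])
      hα0.le hα1.le
    have hsplit : (m : ℝ) = (m + 1) * (1 + -(1 / ((m : ℝ) + 1))) := by field_simp; ring
    have hnn : (0 : ℝ) ≤ 1 + -(1 / ((m : ℝ) + 1)) := by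
      rw [← sub_eq_add_neg, sub_nonneg, div_le_one hm]
      linarith [(Nat.cast_nonneg m : (0 : ℝ) ≤ m)]
    have hpow : (m : ℝ) ^ α ≤ ((m : ℝ) + 1) ^ α * (1 + α * -(1 / ((m : ℝ) + 1))) := by
      conv_lhs => rw [hsplit, Real.mul_rpow hm.le hnn]
      gcongr
    have hsub : ((m : ℝ) + 1) ^ (α - 1) = ((m : ℝ) + 1) ^ α / (m + 1) :=
      Real.rpow_sub_one hm.ne' α
    push_cast
    rw [le_div_iff₀ hα0, add_mul, div_mul_cancel₀ _ hα0.ne', hsub]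
    have : ((m : ℝ) + 1) ^ α * (1 + α * -(1 / ((m : ℝ) + 1))) =
      ((m : ℝ) + 1) ^ α - ((m : ℝ) + 1) ^ α / (m + 1) * α := by field_simp; ring
    linarith

theorem antitone_rpow_kernel {α : ℝ} (hα1 : α < 1) :
    Antitone fun i : ℕ => ((i : ℝ) + 1) ^ (α - 1) := fun i j hij =>
  Real.rpow_le_rpow_of_nonpos (by positivity) (by gcongr) (by linarith)

/-! ### Grid functions on the whole line and their translates. -/

section Grid

variable {E : Type*} [NormedAddCommGroup E]

theorem aestronglyMeasurable_comp_ceil (W : ℤ → E) (τ : ℝ) (μ : Measure ℝ) :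
    AEStronglyMeasurable (fun t : ℝ => W ⌈t / τ⌉) μ :=
  ((StronglyMeasurable.of_discrete (f := W)).comp_measurable
    (Int.measurable_ceil.comp (measurable_id.div_const τ))).aestronglyMeasurable

theorem eLpNorm_comp_ceil_add (W : ℤ → E) {τ : ℝ} (hτ : τ ≠ 0) (p : ℝ≥0∞) (s : ℤ) :
    eLpNorm (fun t : ℝ => W (⌈t / τ⌉ + s)) p volume =
      eLpNorm (fun t : ℝ => W ⌈t / τ⌉) p volume := by
  rw [← eLpNorm_comp_measurePreserving (aestronglyMeasurable_comp_ceil W τ volume)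
    (measurePreserving_add_right volume ((s : ℝ) * τ))]
  congr 1
  ext t
  rw [Function.comp_apply, add_div, mul_div_cancel_right₀ _ hτ, Int.ceil_add_intCast]

/-- Young's inequality for a finitely supported kernel. -/
theorem eLpNorm_sum_smul_comp_ceil_le [NormedSpace ℝ E] (W : ℤ → E) {τ : ℝ} (hτ : τ ≠ 0)
    {p : ℝ≥0∞} (hp : 1 ≤ p) (I : Finset ℕ) (b : ℕ → ℝ) (hb : ∀ i ∈ I, 0 ≤ b i) (σ : ℕ → ℤ) :
    eLpNorm (fun t : ℝ => ∑ i ∈ I, b i • W (⌈t / τ⌉ + σ i)) p volume ≤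
      ENNReal.ofReal (∑ i ∈ I, b i) * eLpNorm (fun t : ℝ => W ⌈t / τ⌉) p volume := by
  have hsum : (fun t : ℝ => ∑ i ∈ I, b i • W (⌈t / τ⌉ + σ i)) =
      ∑ i ∈ I, b i • fun t : ℝ => W (⌈t / τ⌉ + σ i) := by
    ext t; simp
  rw [hsum, ENNReal.ofReal_sum_of_nonneg hb, Finset.sum_mul]
  refine (eLpNorm_sum_le (fun i _ =>
    (aestronglyMeasurable_comp_ceil (fun k => W (k + σ i)) τ volume).const_smul (b i)) hp).trans
    (Finset.sum_le_sum fun i hi => ?_)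
  rw [eLpNorm_const_smul, eLpNorm_comp_ceil_add W hτ, Real.enorm_of_nonneg (hb i hi)]

/-- Telescoping: what remains is the first `m` terms minus a nonnegative tail. -/
theorem sum_range_sub_shift_le {a : ℕ → ℝ} (ha0 : ∀ i, 0 ≤ a i) (m M : ℕ) :
    ∑ i ∈ Finset.range M, (a i - a (i + m)) ≤ ∑ i ∈ Finset.range m, a i := by
  have h1 := Finset.sum_range_add a M m
  have h2 := Finset.sum_range_add a m M
  rw [add_comm m M] at h2
  have h3 : 0 ≤ ∑ i ∈ Finset.range m, a (M + i) := Finset.sum_nonneg fun i _ => ha0 _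
  have h4 : ∑ i ∈ Finset.range M, a (i + m) = ∑ i ∈ Finset.range M, a (m + i) :=
    Finset.sum_congr rfl fun i _ => by rw [add_comm]
  rw [Finset.sum_sub_distrib, h4]
  linarith

/-- Convolution with an antitone kernel `a` on the grid: its increments over `m` steps are
controlled by the mass of `a` on the first `m` steps. -/
theorem eLpNorm_conv_shift_sub_le [NormedSpace ℝ E] (W : ℤ → E) {τ : ℝ} (hτ : τ ≠ 0)
    {p : ℝ≥0∞} (hp : 1 ≤ p) {a : ℕ → ℝ} (ha0 : ∀ i, 0 ≤ a i) (ha : Antitone a)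
    {m M : ℕ} (hm : m ≤ M) :
    eLpNorm (fun t : ℝ => ∑ i ∈ Finset.range M, a i • W (⌈t / τ⌉ + m - i) -
        ∑ i ∈ Finset.range M, a i • W (⌈t / τ⌉ - i)) p volume ≤
      ENNReal.ofReal (3 * ∑ i ∈ Finset.range m, a i) *
        eLpNorm (fun t : ℝ => W ⌈t / τ⌉) p volume := by
  -- From here on `M` denotes the length of the overlap of the two kernels, the original length
  -- minus `m`.
  obtain ⟨M, rfl⟩ := Nat.exists_eq_add_of_le hm
  set A := ∑ i ∈ Finset.range m, a i
  let f₁ : ℝ → E := fun t => ∑ i ∈ Finset.range m, a i • W (⌈t / τ⌉ + (m - i : ℤ))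
  let f₂ : ℝ → E := fun t =>
    ∑ i ∈ Finset.range M, (a i - a (i + m)) • W (⌈t / τ⌉ + (-i : ℤ))
  let f₃ : ℝ → E := fun t => ∑ i ∈ Finset.range m, a (M + i) • W (⌈t / τ⌉ + (-(M + i) : ℤ))
  -- `f₁` holds the terms only in the shifted sum, `f₂` the kernel differences on the overlap, `f₃`
  -- the terms only in the unshifted sum. Each kernel has mass at most `A`, whence the factor 3.
  have hsplit : (fun t : ℝ => ∑ i ∈ Finset.range (m + M), a i • W (⌈t / τ⌉ + m - i) -
        ∑ i ∈ Finset.range (m + M), a i • W (⌈t / τ⌉ - i)) = f₁ - f₂ - f₃ := by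
    ext t
    simp only [f₁, f₂, f₃, Pi.sub_apply, sub_smul, Finset.sum_sub_distrib]
    rw [Finset.sum_range_add, show Finset.range (m + M) = Finset.range (M + m) by rw [add_comm],
      Finset.sum_range_add]
    have e1 : ∀ i : ℕ, ⌈t / τ⌉ + (m : ℤ) - ((m + i : ℕ) : ℤ) = ⌈t / τ⌉ + -(i : ℤ) := by
      intro i; push_cast; ring
    have e2 : ∀ i : ℕ, ⌈t / τ⌉ - ((M + i : ℕ) : ℤ) = ⌈t / τ⌉ + -((M : ℤ) + i) := by
      intro i; push_cast; ring
    have e3 : ∀ i : ℕ, ⌈t / τ⌉ + (m : ℤ) - i = ⌈t / τ⌉ + (m - i) := fun i => by ring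
    have e4 : ∀ i : ℕ, ⌈t / τ⌉ - (i : ℤ) = ⌈t / τ⌉ + -i := fun i => by ring
    simp only [e1, e2, e3, e4, fun i => add_comm i m]
    abel
  have h₁ : eLpNorm f₁ p volume ≤ ENNReal.ofReal A * eLpNorm (fun t : ℝ => W ⌈t / τ⌉) p volume :=
    eLpNorm_sum_smul_comp_ceil_le W hτ hp _ _ (fun i _ => ha0 i) _
  have h₂ : eLpNorm f₂ p volume ≤ ENNReal.ofReal A * eLpNorm (fun t : ℝ => W ⌈t / τ⌉) p volume :=
    (eLpNorm_sum_smul_comp_ceil_le W hτ hp _ (fun i => a i - a (i + m))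
      (fun i _ => sub_nonneg.2 (ha (Nat.le_add_right i m))) _).trans (by
        gcongr; exact sum_range_sub_shift_le ha0 m M)
  have h₃ : eLpNorm f₃ p volume ≤ ENNReal.ofReal A * eLpNorm (fun t : ℝ => W ⌈t / τ⌉) p volume :=
    (eLpNorm_sum_smul_comp_ceil_le W hτ hp _ (fun i => a (M + i)) (fun i _ => ha0 _) _).trans (by
        gcongr; exact Finset.sum_le_sum fun i _ => ha (Nat.le_add_left i M))
  have hm₁ : AEStronglyMeasurable f₁ volume := aestronglyMeasurable_comp_ceil
    (fun k => ∑ i ∈ Finset.range m, a i • W (k + (m - i : ℤ))) τ volume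
  have hm₂ : AEStronglyMeasurable f₂ volume := aestronglyMeasurable_comp_ceil
    (fun k => ∑ i ∈ Finset.range M, (a i - a (i + m)) • W (k + (-i : ℤ))) τ volume
  have hm₃ : AEStronglyMeasurable f₃ volume := aestronglyMeasurable_comp_ceil
    (fun k => ∑ i ∈ Finset.range m, a (M + i) • W (k + (-(M + i) : ℤ))) τ volume
  rw [hsplit]
  refine (eLpNorm_sub_le (hm₁.sub hm₂) hm₃ hp).trans
    ((add_le_add ((eLpNorm_sub_le hm₁ hm₂ hp).trans (add_le_add h₁ h₂)) h₃).trans (le_of_eq ?_))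
  rw [ENNReal.ofReal_mul (by norm_num), show ENNReal.ofReal 3 = 3 by norm_num]
  ring

/-- Extension by zero of the values `v 1, …, v N` to all integers. -/
def zeroExtend (N : ℕ) (v : ℕ → E) (k : ℤ) : E :=
  if 1 ≤ k ∧ k ≤ N then v k.toNat else 0

theorem zeroExtend_of_le (N : ℕ) (v : ℕ → E) {k : ℤ} (hk : k ≤ 0) : zeroExtend N v k = 0 :=
  if_neg fun h => by omega

theorem zeroExtend_natCast {N : ℕ} (v : ℕ → E) {k : ℕ} (h1 : 1 ≤ k) (h2 : k ≤ N) :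
    zeroExtend N v k = v k := by
  rw [zeroExtend, if_pos ⟨by omega, by omega⟩, Int.toNat_natCast]

theorem mem_Ioc_iff_ceil_eq {τ : ℝ} (hτ : 0 < τ) (k : ℤ) (t : ℝ) :
    t ∈ Ioc (((k : ℝ) - 1) * τ) ((k : ℝ) * τ) ↔ ⌈t / τ⌉ = k := by
  rw [Int.ceil_eq_iff, lt_div_iff₀ hτ, div_le_iff₀ hτ, mem_Ioc]

theorem stepFun_eq {τ : ℝ} (hτ : 0 < τ) (N : ℕ) (v : ℕ → E) (t : ℝ) :
    stepFun τ N v t = zeroExtend N v ⌈t / τ⌉ := by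
  have hind : ∀ k : ℕ, (Ioc (((k : ℝ) - 1) * τ) ((k : ℝ) * τ)).indicator (fun _ => v k) t =
      if ⌈t / τ⌉ = k then v k else 0 := by
    intro k
    have h := mem_Ioc_iff_ceil_eq hτ (k : ℤ) t
    rw [Int.cast_natCast] at h
    rw [indicator_apply]
    exact if_congr h rfl rfl
  rw [stepFun, Finset.sum_congr rfl fun k _ => hind k, zeroExtend]
  split_ifs with h
  · rw [Finset.sum_eq_single_of_mem ⌈t / τ⌉.toNat (Finset.mem_Icc.2 (by omega))
      fun k _ hk => if_neg (by omega), if_pos (by omega)]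
  · exact Finset.sum_eq_zero fun k hk => if_neg (by have := Finset.mem_Icc.1 hk; omega)

theorem mem_Ioc_iff_ceil_mem {T : ℝ} (hT : 0 < T) {N : ℕ} (hN : 1 ≤ N) (t : ℝ) :
    t ∈ Ioc 0 T ↔ 1 ≤ ⌈t / (T / N)⌉ ∧ ⌈t / (T / N)⌉ ≤ N := by
  have hN' : (0 : ℝ) < N := by exact_mod_cast hN
  have hτ : 0 < T / N := by positivity
  rw [Int.one_le_ceil_iff, Int.ceil_le, Int.cast_natCast, div_le_iff₀ hτ,
    mul_div_cancel₀ _ hN'.ne', mem_Ioc]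
  exact and_congr_left' ⟨fun h => by positivity, fun h => by
    have := mul_pos h hτ; rwa [div_mul_cancel₀ _ hτ.ne'] at this⟩

/-- Passing to the whole line makes the norm translation invariant. -/
theorem eLpNorm_stepFun {T : ℝ} (hT : 0 < T) {N : ℕ} (hN : 1 ≤ N) (v : ℕ → E) (p : ℝ≥0∞) :
    eLpNorm (stepFun (T / N) N v) p (volume.restrict (Ioo 0 T)) =
      eLpNorm (fun t : ℝ => zeroExtend N v ⌈t / (T / N)⌉) p volume := by
  have hN' : (0 : ℝ) < N := by exact_mod_cast hN
  rw [Measure.restrict_congr_set Ioo_ae_eq_Ioc,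
    ← eLpNorm_indicator_eq_eLpNorm_restrict measurableSet_Ioc]
  congr 1
  ext t
  by_cases ht : t ∈ Ioc 0 T
  · rw [indicator_of_mem ht, stepFun_eq (by positivity)]
  · rw [indicator_of_notMem ht, zeroExtend, if_neg fun h => ht ((mem_Ioc_iff_ceil_mem hT hN t).2 h)]

theorem memLp_stepFun (τ : ℝ) (N : ℕ) (v : ℕ → E) (p : ℝ≥0∞) (T : ℝ) :
    MemLp (stepFun τ N v) p (volume.restrict (Ioo 0 T)) := by
  have : stepFun τ N v = ∑ k ∈ Finset.Icc 1 N,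
      (Ioc (((k : ℝ) - 1) * τ) ((k : ℝ) * τ)).indicator (fun _ => v k) := by
    ext t; simp [stepFun]
  rw [this]
  exact memLp_finsetSum' _ fun k _ => (memLp_const _).indicator measurableSet_Ioc

end Grid

/-- Ehrling's lemma. -/
theorem IsCompactOperator.exists_norm_le_add {X B Y : Type*}
    [NormedAddCommGroup X] [NormedSpace ℝ X] [NormedAddCommGroup B] [NormedSpace ℝ B]
    [NormedAddCommGroup Y] [NormedSpace ℝ Y]
    {i : X →L[ℝ] B} (hi : IsCompactOperator i) {j : B →L[ℝ] Y}
    (hj : Function.Injective j) {η : ℝ} (hη : 0 < η) :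
    ∃ C : ℝ, 0 ≤ C ∧ ∀ x, ‖i x‖ ≤ η * ‖x‖ + C * ‖j (i x)‖ := by
  have hK : IsCompact (closure (i '' Metric.closedBall 0 1)) :=
    hi.isCompact_closure_image_closedBall 1
  -- These increasing open sets cover `B` because `j` is injective, so one of them contains the
  -- compact closure of the image of the unit ball. Homogeneity then gives every `x`.
  obtain ⟨n, hn⟩ := hK.elim_directed_cover (fun n : ℕ => {b : B | ‖b‖ < η + n * ‖j b‖})
    (fun n => isOpen_lt (by fun_prop) (by fun_prop))
    (fun b _ => by
      rw [mem_iUnion]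
      rcases eq_or_ne b 0 with rfl | hb
      · exact ⟨0, by simpa using hη⟩
      · have hjb : 0 < ‖j b‖ := norm_pos_iff.2 fun h => hb (hj (by rw [h, map_zero]))
        obtain ⟨n, hn⟩ := exists_nat_gt (‖b‖ / ‖j b‖)
        rw [div_lt_iff₀ hjb] at hn
        exact ⟨n, by simp only [mem_ofPred_eq]; linarith⟩)
    (Monotone.directed_le fun n m hnm b hb => by
      rw [mem_ofPred_eq] at hb ⊢
      refine hb.trans_le ?_
      gcongr)
  refine ⟨n, by positivity, fun x => ?_⟩
  rcases eq_or_ne x 0 with rfl | hx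
  · simp
  have hx' : 0 < ‖x‖ := norm_pos_iff.2 hx
  have h := hn (subset_closure (mem_image_of_mem i
    (show ‖x‖⁻¹ • x ∈ Metric.closedBall 0 1 by
      rw [mem_closedBall_zero_iff, norm_smul, norm_inv, norm_norm, inv_mul_cancel₀ hx'.ne'])))
  simp only [mem_ofPred_eq, map_smul, norm_smul, norm_inv, norm_norm] at h
  have h2 := (mul_lt_mul_of_pos_left h hx').le
  rw [mul_inv_cancel_left₀ hx'.ne'] at h2
  refine h2.trans (le_of_eq ?_)
  field_simp

/-! ### Averages over a coarse grid, compared on the common refinement into `L * N` cells. -/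

section GridAverage

variable {E : Type*} [NormedAddCommGroup E] [NormedSpace ℝ E]

/-- With `N` blocks of `L` cells carrying the values `v 1, …, v N`, the average of these values
over the `i`-th of `L` blocks of `N` cells. -/
noncomputable def gridAverage (N L : ℕ) (v : ℕ → E) (i : ℕ) : E :=
  (N : ℝ)⁻¹ • ∑ r ∈ Finset.range N, v (((i - 1) * N + r) / L + 1)

theorem ContinuousLinearMap.map_gridAverage {F : Type*} [NormedAddCommGroup F] [NormedSpace ℝ F]
    (j : E →L[ℝ] F) (N L : ℕ) (v : ℕ → E) (i : ℕ) :
    j (gridAverage N L v i) = gridAverage N L (fun k => j (v k)) i := by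
  simp [gridAverage, map_sum]

/-- The fine cells of the block containing `c` lie at offsets in `(-N, N)` from `c`. Summing over
all these offsets replaces a block that depends on `c` by fixed shifts, to which translation
invariance applies. -/
theorem norm_sub_gridAverage_le {N L : ℕ} (hN : 1 ≤ N) {v : ℕ → E} {e : E}
    {P : ℤ → ℝ} (hP : ∀ s, 0 ≤ P s) {c : ℤ} (hc1 : 1 ≤ c) (hcL : (c - 1) / N + 1 ≤ L)
    (h : ∀ c' : ℤ, 1 ≤ c' → c' ≤ L * N → ‖e - v ((c' - 1) / L + 1).toNat‖ ≤ P (c' - c)) :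
    ‖e - gridAverage N L v ((c - 1) / N + 1).toNat‖ ≤
      (N : ℝ)⁻¹ * ∑ s ∈ Finset.Ioo (-(N : ℤ)) N, P s := by
  have hN' : (N : ℝ) ≠ 0 := by positivity
  have hNZ : (0 : ℤ) < N := by omega
  set q : ℤ := (c - 1) / N with hq
  have hq0 : 0 ≤ q := Int.ediv_nonneg (by omega) (by omega)
  have hdm : (N : ℤ) * q + (c - 1) % N = c - 1 := Int.mul_ediv_add_emod (c - 1) N
  have hm0 := Int.emod_nonneg (c - 1) hNZ.ne'
  have hm1 := Int.emod_lt_of_pos (c - 1) hNZ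
  have hqn : ((q + 1).toNat - 1 : ℕ) = q.toNat := by omega
  have havg : e - gridAverage N L v (q + 1).toNat =
      (N : ℝ)⁻¹ • ∑ r ∈ Finset.range N, (e - v ((q.toNat * N + r) / L + 1)) := by
    rw [gridAverage, hqn, Finset.sum_sub_distrib, Finset.sum_const, Finset.card_range, smul_sub,
      ← Nat.cast_smul_eq_nsmul ℝ, inv_smul_smul₀ hN']
  have hbound : q * N + N ≤ L * N := by nlinarith
  rw [havg, norm_smul, norm_inv, Real.norm_natCast]
  refine mul_le_mul_of_nonneg_left ((norm_sum_le _ _).trans ?_) (by positivity)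
  have hterm : ∀ r ∈ Finset.range N, ‖e - v ((q.toNat * N + r) / L + 1)‖ ≤
      P (q * N + 1 + r - c) := by
    intro r hr
    have hr' : (r : ℤ) < N := by exact_mod_cast Finset.mem_range.1 hr
    have := h (q * N + 1 + r) (by linarith [mul_nonneg hq0 hNZ.le]) (by linarith)
    convert this using 4
    have : ((((q.toNat * N + r) / L + 1 : ℕ)) : ℤ) = (q * N + 1 + r - 1) / L + 1 := by
      push_cast
      rw [Int.toNat_of_nonneg hq0]
      congr 2
      ring
    rw [← this, Int.toNat_natCast]
  refine (Finset.sum_le_sum hterm).trans ?_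
  have hinj : Set.InjOn (fun r : ℕ => q * N + 1 + r - c) (Finset.range N) :=
    fun r _ r' _ hrr => by simp only at hrr; omega
  rw [← Finset.sum_image (f := P) hinj]
  refine Finset.sum_le_sum_of_subset_of_nonneg ?_ fun s _ _ => hP s
  intro s hs
  obtain ⟨r, hr, rfl⟩ := Finset.mem_image.1 hs
  have hr' : (r : ℤ) < N := by exact_mod_cast Finset.mem_range.1 hr
  rw [Finset.mem_Ioo]
  constructor <;> linarith [mul_comm q (N : ℤ), (Int.natCast_nonneg r)]

/-- There are fewer than `2 * N` offsets, each of weight `1 / N`. -/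
theorem eLpNorm_le_two_mul {F : Type*} [NormedAddCommGroup F] {p : ℝ≥0∞} (hp : 1 ≤ p) {N : ℕ}
    (hN : 1 ≤ N) {h : ℝ → F} {Q : ℤ → ℝ → ℝ} {K : ℝ≥0∞}
    (hQm : ∀ s, AEStronglyMeasurable (Q s) volume)
    (hQ : ∀ s ∈ Finset.Ioo (-(N : ℤ)) N, eLpNorm (Q s) p volume ≤ K)
    (hh : ∀ t, ‖h t‖ ≤ (N : ℝ)⁻¹ * ∑ s ∈ Finset.Ioo (-(N : ℤ)) N, Q s t) :
    eLpNorm h p volume ≤ 2 * K := by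
  have hN' : (0 : ℝ) < N := by exact_mod_cast hN
  refine (eLpNorm_mono_real hh).trans ?_
  have hsum : (fun t => (N : ℝ)⁻¹ * ∑ s ∈ Finset.Ioo (-(N : ℤ)) N, Q s t) =
      (N : ℝ)⁻¹ • ∑ s ∈ Finset.Ioo (-(N : ℤ)) N, Q s := by
    ext t; simp
  rw [hsum, eLpNorm_const_smul]
  have hcard : (Finset.Ioo (-(N : ℤ)) N).card ≤ 2 * N := by
    rw [Int.card_Ioo]; omega
  calc ‖(N : ℝ)⁻¹‖ₑ * eLpNorm (∑ s ∈ Finset.Ioo (-(N : ℤ)) N, Q s) p volume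
      ≤ ‖(N : ℝ)⁻¹‖ₑ * ((2 * N : ℕ) * K) := by
        gcongr
        refine (eLpNorm_sum_le (fun s _ => hQm s) hp).trans ((Finset.sum_le_sum hQ).trans ?_)
        rw [Finset.sum_const, nsmul_eq_mul]
        gcongr
    _ = 2 * K := by
        rw [← mul_assoc, Real.enorm_of_nonneg (by positivity), ← ENNReal.ofReal_natCast,
          ← ENNReal.ofReal_mul (by positivity)]
        congr 1
        rw [show (N : ℝ)⁻¹ * ((2 * N : ℕ) : ℝ) = 2 by push_cast; field_simp]
        norm_num

/-- Cells are half-open on the left and numbered from 1, hence the shift by one around the integer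
division. -/
theorem Int.ceil_div_eq_ediv (x : ℝ) {L : ℕ} (hL : 1 ≤ L) :
    ⌈x / L⌉ = (⌈x⌉ - 1) / (L : ℤ) + 1 := by
  have hL' : (0 : ℝ) < L := by exact_mod_cast hL
  have hLZ : (0 : ℤ) < L := by exact_mod_cast hL
  have h1 := Int.mul_ediv_add_emod (⌈x⌉ - 1) L
  have h2 := Int.emod_nonneg (⌈x⌉ - 1) hLZ.ne'
  have h3 := Int.emod_lt_of_pos (⌈x⌉ - 1) hLZ
  set q := (⌈x⌉ - 1) / (L : ℤ)
  have h4 : L * q < ⌈x⌉ := by linarith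
  have h5 : ⌈x⌉ ≤ L * q + L := by linarith
  rw [Int.lt_ceil] at h4
  rw [Int.ceil_le] at h5
  push_cast at h4 h5
  rw [Int.ceil_eq_iff, lt_div_iff₀ hL', div_le_iff₀ hL']
  push_cast
  constructor <;> linarith

theorem div_div_eq_refine (t T : ℝ) (N : ℕ) {L : ℕ} (hL : 1 ≤ L) :
    t / (T / N) = t / (T / (N * L)) / L := by
  have hL' : (L : ℝ) ≠ 0 := by positivity
  rw [div_div_eq_mul_div, div_div_eq_mul_div, div_div, mul_comm T (L : ℝ), ← mul_assoc,
    mul_comm (t * N), mul_div_mul_left _ _ hL']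

theorem ceil_div_refine (t T : ℝ) (N : ℕ) {L : ℕ} (hL : 1 ≤ L) :
    ⌈t / (T / N)⌉ = (⌈t / (T / (N * L))⌉ - 1) / (L : ℤ) + 1 := by
  rw [div_div_eq_refine t T N hL, Int.ceil_div_eq_ediv _ hL]

theorem cell_bounds {L N : ℕ} (hL : 1 ≤ L) {c : ℤ} (h1 : 1 ≤ c) (h2 : c ≤ L * N) :
    1 ≤ (c - 1) / (L : ℤ) + 1 ∧ (c - 1) / (L : ℤ) + 1 ≤ N := by
  have hLZ : (0 : ℤ) < L := by exact_mod_cast hL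
  have := Int.ediv_nonneg (a := c - 1) (b := L) (by omega) hLZ.le
  have := Int.ediv_lt_of_lt_mul (a := c - 1) (b := N) hLZ (by rw [mul_comm]; omega)
  omega

theorem cell_pos_of_ediv_pos {L : ℕ} (hL : 1 ≤ L) {c : ℤ} (h : 1 ≤ (c - 1) / (L : ℤ) + 1) :
    1 ≤ c := by
  by_contra hc
  have := Int.ediv_neg_of_neg_of_pos (a := c - 1) (b := L) (by omega) (by omega)
  omega

/-- Averaging over the coarse grid is bounded in `L^p`. -/
theorem eLpNorm_gridAverage_le {p : ℝ≥0∞} (hp : 1 ≤ p) {T : ℝ} (hT : 0 < T) {N L : ℕ}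
    (hN : 1 ≤ N) (hL : 1 ≤ L) (v : ℕ → E) :
    eLpNorm (fun t : ℝ => zeroExtend L (gridAverage N L v) ⌈t / (T / L)⌉) p volume ≤
      2 * eLpNorm (fun t : ℝ => zeroExtend N v ⌈t / (T / N)⌉) p volume := by
  have hτ : T / (N * L) ≠ 0 := by positivity
  let W : ℤ → E := fun c => zeroExtend N v ((c - 1) / (L : ℤ) + 1)
  have hW : (fun t : ℝ => zeroExtend N v ⌈t / (T / N)⌉) = fun t => W ⌈t / (T / (N * L))⌉ := by
    ext t; rw [ceil_div_refine t T N hL]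
  rw [hW]
  refine eLpNorm_le_two_mul hp hN (Q := fun s t => ‖W (⌈t / (T / (N * L))⌉ + s)‖)
    (fun s => (aestronglyMeasurable_comp_ceil (fun c => W (c + s)) _ _).norm)
    (fun s _ => ?_) fun t => ?_
  · rw [eLpNorm_norm, eLpNorm_comp_ceil_add W hτ]
  · set c := ⌈t / (T / (N * L))⌉
    have hi : ⌈t / (T / L)⌉ = (c - 1) / (N : ℤ) + 1 := by
      rw [ceil_div_refine t T L hN, mul_comm (L : ℝ)]
    rw [hi, zeroExtend]
    split_ifs with h
    · rw [← norm_neg, ← zero_sub]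
      refine norm_sub_gridAverage_le hN (P := fun s => ‖W (c + s)‖) (fun s => norm_nonneg _)
        (cell_pos_of_ediv_pos hN h.1) h.2 fun c' h1 h2 => ?_
      rw [zero_sub, norm_neg, add_sub_cancel]
      simp only [W]
      rw [zeroExtend, if_pos (cell_bounds hL h1 h2)]
    · rw [norm_zero]
      positivity

/-- The `L^p` distance to the average over the coarse grid is controlled by increments over at
most one cell of the coarse grid. -/
theorem eLpNorm_sub_gridAverage_le {p : ℝ≥0∞} (hp : 1 ≤ p) {T : ℝ} (hT : 0 < T) {N L : ℕ}
    (hN : 1 ≤ N) (hL : 1 ≤ L) (v : ℕ → E) (U : ℤ → E)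
    (hU : ∀ k k' : ℤ, 1 ≤ k → k ≤ N → 1 ≤ k' → k' ≤ N → v k.toNat - v k'.toNat = U k - U k')
    {K : ℝ≥0∞} (hK : ∀ s : ℤ, |s| ≤ (N / L + 1 : ℕ) →
      eLpNorm (fun t : ℝ => U (⌈t / (T / N)⌉ + s) - U ⌈t / (T / N)⌉) p volume ≤ K) :
    eLpNorm (fun t : ℝ => zeroExtend N v ⌈t / (T / N)⌉ -
      zeroExtend L (gridAverage N L v) ⌈t / (T / L)⌉) p volume ≤ 4 * K := by
  have hLZ : (0 : ℤ) < L := by exact_mod_cast hL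
  let H : ℤ → ℝ → E := fun s t => U (⌈t / (T / N)⌉ + s) - U ⌈t / (T / N)⌉
  have hH : ∀ s, AEStronglyMeasurable (H s) volume := fun s =>
    aestronglyMeasurable_comp_ceil (fun k => U (k + s) - U k) _ _
  rw [show (4 : ℝ≥0∞) * K = 2 * (K + K) by ring]
  -- An offset of `s` fine cells changes the index of the original cell by `s / L` or `s / L + 1`,
  -- depending on the position in the cell. Admitting both costs the second factor 2.
  refine eLpNorm_le_two_mul hp hN (Q := fun s t => ‖H (s / L) t‖ + ‖H (s / L + 1) t‖)
    (fun s => (hH _).norm.add (hH _).norm) (fun s hs => ?_) fun t => ?_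
  · rw [Finset.mem_Ioo] at hs
    refine (eLpNorm_add_le (hH _).norm (hH _).norm hp).trans ?_
    rw [eLpNorm_norm, eLpNorm_norm]
    have hup : s / L ≤ (N : ℤ) / L := Int.ediv_le_ediv hLZ hs.2.le
    have hlow : -((N : ℤ) / L) - 1 ≤ s / L := by
      rw [Int.le_ediv_iff_mul_le hLZ]
      have := Int.lt_ediv_add_one_mul_self (N : ℤ) hLZ
      linarith
    refine add_le_add (hK _ ?_) (hK _ ?_) <;>
    · rw [abs_le]; push_cast; constructor <;> omega
  · set c := ⌈t / (T / (N * L))⌉ with hc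
    have hi : ⌈t / (T / L)⌉ = (c - 1) / (N : ℤ) + 1 := by
      rw [ceil_div_refine t T L hN, mul_comm (L : ℝ)]
    have hk : ⌈t / (T / N)⌉ = (c - 1) / (L : ℤ) + 1 := ceil_div_refine t T N hL
    by_cases ht : t ∈ Ioc 0 T
    · have htN := (mem_Ioc_iff_ceil_mem hT hN t).1 ht
      have htL := (mem_Ioc_iff_ceil_mem hT hL t).1 ht
      rw [zeroExtend, if_pos htN, zeroExtend, if_pos htL]
      rw [hi] at htL ⊢
      refine norm_sub_gridAverage_le hN (P := fun s => ‖H (s / L) t‖ + ‖H (s / L + 1) t‖)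
        (fun s => by positivity) (cell_pos_of_ediv_pos hN htL.1) htL.2 fun c' h1 h2 => ?_
      have hb := cell_bounds hL h1 h2
      rw [hU _ _ htN.1 htN.2 hb.1 hb.2, norm_sub_rev]
      have hcase : (c' - 1) / (L : ℤ) = (c - 1) / L + (c' - c) / L ∨
          (c' - 1) / (L : ℤ) = (c - 1) / L + (c' - c) / L + 1 := by
        have a1 := Int.mul_ediv_add_emod (c - 1) L
        have a2 := Int.emod_nonneg (c - 1) hLZ.ne'
        have a3 := Int.emod_lt_of_pos (c - 1) hLZ
        have b1 := Int.mul_ediv_add_emod (c' - c) L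
        have b2 := Int.emod_nonneg (c' - c) hLZ.ne'
        have b3 := Int.emod_lt_of_pos (c' - c) hLZ
        have hlo : (c - 1) / (L : ℤ) + (c' - c) / L ≤ (c' - 1) / (L : ℤ) := by
          rw [Int.le_ediv_iff_mul_le hLZ]; nlinarith
        have hhi : (c' - 1) / (L : ℤ) < (c - 1) / (L : ℤ) + (c' - c) / L + 2 := by
          rw [Int.ediv_lt_iff_lt_mul hLZ]; nlinarith
        omega
      rcases hcase with h | h
      · refine le_trans (le_of_eq ?_) (le_add_of_nonneg_right (norm_nonneg _))
        simp only [H, hk, h]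
        congr 3
        ring
      · refine le_trans (le_of_eq ?_) (le_add_of_nonneg_left (norm_nonneg _))
        simp only [H, hk, h]
        congr 3
        ring
    · rw [zeroExtend, if_neg fun h => ht ((mem_Ioc_iff_ceil_mem hT hN t).2 h), zeroExtend,
        if_neg fun h => ht ((mem_Ioc_iff_ceil_mem hT hL t).2 h), sub_zero, norm_zero]
      positivity

end GridAverage

/-! ### Time increments of the discrete fractional integral. -/

/-- The discrete fractional integral, over `M` steps, of a grid function. -/
noncomputable def discreteFracIntegral {E : Type*} [NormedAddCommGroup E] [NormedSpace ℝ E]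
    (α τ : ℝ) (M : ℕ) (W : ℤ → E) (k : ℤ) : E :=
  (Real.Gamma α * τ ^ (-α))⁻¹ • ∑ i ∈ Finset.range M, ((i : ℝ) + 1) ^ (α - 1) • W (k - i)

/-- The length `N` does not depend on `k`, which makes this a true convolution; the terms beyond the
`k`-th vanish by the extension by zero. -/
theorem discreteFracIntegral_discreteCaputo {E : Type*} [NormedAddCommGroup E] [NormedSpace ℝ E]
    {α τ : ℝ} (hα : 0 < α) (hτ : 0 < τ) (g : ℕ → E) {N k : ℕ} (hk : k ≤ N) :
    discreteFracIntegral α τ N (zeroExtend N (discreteCaputo α τ g)) k = g k - g 0 := by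
  have hc : Real.Gamma α * τ ^ (-α) ≠ 0 :=
    (mul_pos (Real.Gamma_pos_of_pos hα) (Real.rpow_pos_of_pos hτ _)).ne'
  rw [discreteFracIntegral, inv_smul_eq_iff₀ hc, ← sum_rpow_smul_discreteCaputo]
  refine (Finset.sum_subset_zero_on_sdiff (Finset.range_mono hk) (fun i hi => ?_)
    fun i hi => ?_).symm
  · simp only [Finset.mem_sdiff, Finset.mem_range] at hi
    rw [zeroExtend_of_le _ _ (by omega), smul_zero]
  · have hi := Finset.mem_range.1 hi
    rw [← Nat.cast_sub hi.le, zeroExtend_natCast _ (by omega) (by omega)]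

theorem eLpNorm_discreteFracIntegral_shift_sub_le {E : Type*} [NormedAddCommGroup E]
    [NormedSpace ℝ E] {α τ : ℝ} (hα0 : 0 < α) (hα1 : α < 1) (hτ : 0 < τ) {p : ℝ≥0∞} (hp : 1 ≤ p)
    (W : ℤ → E) {M : ℕ} {s : ℤ} (hs : |s| ≤ M) :
    eLpNorm (fun t : ℝ => discreteFracIntegral α τ M W (⌈t / τ⌉ + s) -
        discreteFracIntegral α τ M W ⌈t / τ⌉) p volume ≤
      ENNReal.ofReal (3 * (|s| * τ) ^ α / (Real.Gamma α * α)) *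
        eLpNorm (fun t : ℝ => W ⌈t / τ⌉) p volume := by
  set u := discreteFracIntegral α τ M W with hu
  have hΓ := Real.Gamma_pos_of_pos hα0
  have key : ∀ m : ℕ, m ≤ M → eLpNorm (fun t : ℝ => u (⌈t / τ⌉ + m) - u ⌈t / τ⌉) p volume ≤
      ENNReal.ofReal (3 * (m * τ) ^ α / (Real.Gamma α * α)) *
        eLpNorm (fun t : ℝ => W ⌈t / τ⌉) p volume := by
    intro m hm
    have h := eLpNorm_conv_shift_sub_le W hτ.ne' hp
      (a := fun i : ℕ => ((i : ℝ) + 1) ^ (α - 1)) (fun i => by positivity)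
      (antitone_rpow_kernel hα1) hm
    have hfun : (fun t : ℝ => u (⌈t / τ⌉ + m) - u ⌈t / τ⌉) =
        (Real.Gamma α * τ ^ (-α))⁻¹ • fun t : ℝ =>
          ∑ i ∈ Finset.range M, ((i : ℝ) + 1) ^ (α - 1) • W (⌈t / τ⌉ + m - i) -
          ∑ i ∈ Finset.range M, ((i : ℝ) + 1) ^ (α - 1) • W (⌈t / τ⌉ - i) := by
      ext t
      simp only [hu, discreteFracIntegral, Pi.smul_apply, smul_sub]
    have hc : (0 : ℝ) ≤ (Real.Gamma α * τ ^ (-α))⁻¹ := by positivity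
    rw [hfun, eLpNorm_const_smul, Real.enorm_of_nonneg hc]
    refine (mul_le_mul_right h _).trans ?_
    rw [← mul_assoc, ← ENNReal.ofReal_mul hc]
    gcongr
    have hA := sum_range_rpow_le hα0 hα1 m
    calc (Real.Gamma α * τ ^ (-α))⁻¹ * (3 * ∑ i ∈ Finset.range m, ((i : ℝ) + 1) ^ (α - 1))
        ≤ (Real.Gamma α * τ ^ (-α))⁻¹ * (3 * ((m : ℝ) ^ α / α)) := by gcongr
      _ = 3 * (m * τ) ^ α / (Real.Gamma α * α) := by
        rw [Real.mul_rpow (by positivity) hτ.le, Real.rpow_neg hτ.le]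
        have := (Real.rpow_pos_of_pos hτ α).ne'
        field_simp
  rcases le_total 0 s with h0 | h0
  · lift s to ℕ using h0
    rw [Nat.abs_cast] at hs ⊢
    exact_mod_cast key s (by omega)
  · obtain ⟨m, rfl⟩ : ∃ m : ℕ, s = -m := ⟨s.natAbs, by omega⟩
    rw [abs_neg, Nat.abs_cast] at hs ⊢
    refine le_trans (le_of_eq ?_) (key m (by omega))
    -- A backward increment is, up to sign, a translate of the forward one.
    rw [← eLpNorm_comp_ceil_add (fun k => u (k + m) - u k) hτ.ne' p (-m), ← eLpNorm_neg]
    congr 1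
    ext t
    simp [Pi.neg_apply]

/-! ### Compactness on a fixed grid. -/

/-- By Tychonoff the product of copies of `K` is compact, and the step function depends continuously
on its finitely many relevant coordinates. -/
theorem isCompact_image_toLp_stepFun {B : Type*} [NormedAddCommGroup B]
    (p : ℝ≥0∞) [Fact (1 ≤ p)] (τ T : ℝ) (n : ℕ) {K : Set B} (hK : IsCompact K) :
    IsCompact ((fun w : ℕ → B => (memLp_stepFun τ n w p T).toLp (stepFun τ n w)) ''
      univ.pi fun _ => K) := by
  refine (isCompact_univ_pi fun _ => hK).image (continuous_iff_continuousAt.2 fun w₀ => ?_)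
  rw [ContinuousAt, tendsto_iff_edist_tendsto_0]
  set μ := volume.restrict (Ioo 0 T)
  have hlim : Filter.Tendsto (fun w : ℕ → B => μ univ ^ p.toReal⁻¹ *
      ENNReal.ofReal (∑ k ∈ Finset.Icc 1 n, ‖w k - w₀ k‖)) (nhds w₀) (nhds 0) := by
    have hcont : Continuous fun w : ℕ → B => ∑ k ∈ Finset.Icc 1 n, ‖w k - w₀ k‖ := by
      fun_prop
    have h0 : Filter.Tendsto (fun w : ℕ → B => ∑ k ∈ Finset.Icc 1 n, ‖w k - w₀ k‖) (nhds w₀)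
        (nhds 0) := by
      simpa using hcont.tendsto w₀
    have h1 := ENNReal.tendsto_ofReal h0
    have h2 := ENNReal.Tendsto.const_mul (a := μ univ ^ p.toReal⁻¹) h1 (Or.inr
      (ENNReal.rpow_ne_top_of_nonneg (by positivity) (measure_ne_top μ _)))
    simpa using h2
  refine tendsto_of_tendsto_of_tendsto_of_le_of_le tendsto_const_nhds hlim (fun _ => zero_le)
    fun w => ?_
  simp only
  rw [Lp.edist_toLp_toLp]
  refine eLpNorm_le_of_ae_bound (Filter.Eventually.of_forall fun t => ?_)
  rw [Pi.sub_apply, stepFun, stepFun, ← Finset.sum_sub_distrib]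
  refine (norm_sum_le _ _).trans (Finset.sum_le_sum fun k _ => ?_)
  by_cases ht : t ∈ Ioc (((k : ℝ) - 1) * τ) ((k : ℝ) * τ) <;> simp [ht]

theorem exists_norm_le_of_eLpNorm_zeroExtend_le {X : Type*} [NormedAddCommGroup X]
    {p : ℝ≥0∞} (hp : 1 ≤ p) {τ : ℝ} (hτ : 0 < τ) (N : ℕ) {C : ℝ} (hC : 0 ≤ C) :
    ∃ R : ℝ, ∀ v : ℕ → X,
      eLpNorm (fun t : ℝ => zeroExtend N v ⌈t / τ⌉) p volume ≤ ENNReal.ofReal C →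
      ∀ k, 1 ≤ k → k ≤ N → ‖v k‖ ≤ R := by
  have hpos : 0 < τ ^ (1 / p.toReal) := Real.rpow_pos_of_pos hτ _
  -- One cell alone contributes `‖v k‖ * τ ^ (1 / p)`. For `p = ∞` the exponent `1 / p.toReal` is `1
  -- / 0 = 0`, the correct value.
  refine ⟨C / τ ^ (1 / p.toReal), fun v hv k h1 h2 => ?_⟩
  have hvol : volume (Ioc (((k : ℝ) - 1) * τ) ((k : ℝ) * τ)) = ENNReal.ofReal τ := by
    rw [Real.volume_Ioc]; congr 1; ring
  have h : eLpNorm ((Ioc (((k : ℝ) - 1) * τ) ((k : ℝ) * τ)).indicator fun _ => v k) p volume ≤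
      ENNReal.ofReal C := by
    refine (eLpNorm_mono fun t => ?_).trans hv
    by_cases ht : t ∈ Ioc (((k : ℝ) - 1) * τ) ((k : ℝ) * τ)
    · have hk := (mem_Ioc_iff_ceil_eq hτ (k : ℤ) t).1 (by simpa using ht)
      rw [indicator_of_mem ht, hk, zeroExtend_natCast v h1 h2]
    · rw [indicator_of_notMem ht, norm_zero]
      exact norm_nonneg _
  rw [eLpNorm_indicator_const' measurableSet_Ioc (by rw [hvol]; simpa using hτ)
    (by positivity), hvol, ENNReal.ofReal_rpow_of_pos hτ, ← ofReal_norm,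
    ← ENNReal.ofReal_mul (norm_nonneg _), ENNReal.ofReal_le_ofReal_iff hC] at h
  rwa [le_div_iff₀ hpos]

theorem map_zeroExtend {E F : Type*} [NormedAddCommGroup E] [NormedSpace ℝ E]
    [NormedAddCommGroup F] [NormedSpace ℝ F] (j : E →L[ℝ] F) (N : ℕ) (v : ℕ → E) (k : ℤ) :
    zeroExtend N (fun k => j (v k)) k = j (zeroExtend N v k) := by
  rw [zeroExtend, zeroExtend]
  split_ifs <;> simp

/-! ### Uniform approximation by coarse averages. -/

/-- A bound on the discrete Caputo derivative controls the distance to the coarse averages. -/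
theorem eLpNorm_sub_gridAverage_le_of_discreteCaputo {Y : Type*} [NormedAddCommGroup Y]
    [NormedSpace ℝ Y] {p : ℝ≥0∞} (hp : 1 ≤ p) {α : ℝ} (hα0 : 0 < α) (hα1 : α < 1) {T : ℝ}
    (hT : 0 < T) {N L : ℕ} (hL : 2 ≤ L) (hLN : L ≤ N) (y : Y) (v : ℕ → Y) :
    eLpNorm (fun t : ℝ => zeroExtend N v ⌈t / (T / N)⌉ -
        zeroExtend L (gridAverage N L v) ⌈t / (T / L)⌉) p volume ≤
      4 * (ENNReal.ofReal (3 * (2 * T / L) ^ α / (Real.Gamma α * α)) *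
        eLpNorm (fun t : ℝ => zeroExtend N (discreteCaputo α (T / N) (withInitial y v))
          ⌈t / (T / N)⌉) p volume) := by
  have hL' : (0 : ℝ) < L := by positivity
  have hN' : (0 : ℝ) < N := by exact_mod_cast (by omega : 0 < N)
  have hτ : 0 < T / N := by positivity
  have hΓ := Real.Gamma_pos_of_pos hα0
  refine eLpNorm_sub_gridAverage_le hp hT (by omega) (by omega) v
    (discreteFracIntegral α (T / N) N
      (zeroExtend N (discreteCaputo α (T / N) (withInitial y v)))) (fun k k' h1 h2 h1' h2' => ?_)
    fun s hs => ?_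
  · lift k to ℕ using by omega
    lift k' to ℕ using by omega
    -- The initial value cancels in the difference.
    rw [discreteFracIntegral_discreteCaputo hα0 hτ _ (by omega),
      discreteFracIntegral_discreteCaputo hα0 hτ _ (by omega), sub_sub_sub_cancel_right]
    obtain ⟨a, rfl⟩ : ∃ a, k = a + 1 := ⟨k - 1, by omega⟩
    obtain ⟨b, rfl⟩ : ∃ b, k' = b + 1 := ⟨k' - 1, by omega⟩
    rfl
  -- Here `2 ≤ L` is needed: the shifts must not exceed the length `N` of the kernel.
  · have hle : N / L + 1 ≤ N := by
      have := Nat.div_le_div_left hL (by norm_num) (a := N)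
      omega
    refine (eLpNorm_discreteFracIntegral_shift_sub_le hα0 hα1 hτ hp _
      (hs.trans (by exact_mod_cast hle))).trans ?_
    gcongr
    have hs' : ((|s| : ℤ) : ℝ) ≤ N / L + 1 := by
      refine (Int.cast_le.2 hs).trans ?_
      push_cast
      gcongr
      exact Nat.cast_div_le
    have hone : (1 : ℝ) ≤ N / L := by
      rw [one_le_div hL']; exact_mod_cast hLN
    calc ((|s| : ℤ) : ℝ) * (T / N) ≤ (N / L + N / L) * (T / N) := by gcongr; linarith
      _ = 2 * T / L := by field_simp; ring

theorem exists_gridAverage_approx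
    {X B Y : Type*}
    [NormedAddCommGroup X] [NormedSpace ℝ X] [NormedAddCommGroup B] [NormedSpace ℝ B]
    [NormedAddCommGroup Y] [NormedSpace ℝ Y]
    {iXB : X →L[ℝ] B} (hXB : IsCompactOperator iXB)
    {iBY : B →L[ℝ] Y} (hBY_inj : Function.Injective iBY)
    {p : ℝ≥0∞} (hp : 1 ≤ p) {α : ℝ} (hα0 : 0 < α) (hα1 : α < 1) {T : ℝ} (hT : 0 < T)
    {C : ℝ} (hC : 0 ≤ C) {ε : ℝ} (hε : 0 < ε) :
    ∃ L : ℕ, 1 ≤ L ∧ ∀ N, L ≤ N → ∀ (y : Y) (v : ℕ → X),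
      eLpNorm (fun t : ℝ => zeroExtend N v ⌈t / (T / N)⌉) p volume ≤ ENNReal.ofReal C →
      eLpNorm (fun t : ℝ => zeroExtend N
        (discreteCaputo α (T / N) (withInitial y fun k => iBY (iXB (v k))))
          ⌈t / (T / N)⌉) p volume ≤ ENNReal.ofReal C →
      eLpNorm (fun t : ℝ => zeroExtend N (fun k => iXB (v k)) ⌈t / (T / N)⌉ -
        zeroExtend L (fun k => iXB (gridAverage N L v k)) ⌈t / (T / L)⌉) p volume <
          ENNReal.ofReal ε := by
  -- The bound `3 * C` on the difference in `X` is `C` for the function plus `2 * C` for its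
  -- average; the `+ 1` covers `C = 0`. Ehrling's constant `A` is fixed before `L` is chosen.
  set η : ℝ := ε / (3 * C + 1) / 2 with hη
  have hη0 : 0 < η := by positivity
  have hη1 : η * (3 * C) < ε / 2 := by
    rw [hη, div_div, div_mul_eq_mul_div, div_lt_div_iff₀ (by positivity) (by positivity)]
    nlinarith
  obtain ⟨A, hA0, hA⟩ := hXB.exists_norm_le_add hBY_inj hη0
  have hΓ := Real.Gamma_pos_of_pos hα0
  have hlim : Filter.Tendsto (fun L : ℕ =>
      A * (4 * (3 * (2 * T / (L : ℝ)) ^ α / (Real.Gamma α * α) * C))) Filter.atTop (nhds 0) := by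
    have h1 : Filter.Tendsto (fun L : ℕ => (2 * T / (L : ℝ)) ^ α) Filter.atTop (nhds 0) := by
      have := (tendsto_const_div_atTop_nhds_zero_nat (2 * T)).rpow_const (Or.inr hα0.le)
      rwa [Real.zero_rpow hα0.ne'] at this
    have h2 := ((h1.const_mul 3).div_const (Real.Gamma α * α)).mul_const C
    simpa using (h2.const_mul 4).const_mul A
  obtain ⟨L, hL, hL2⟩ := ((hlim.eventually (gt_mem_nhds (half_pos hε))).and
    (Filter.eventually_ge_atTop 2)).exists
  refine ⟨L, by omega, fun N hLN y v hv hD => ?_⟩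
  let dX : ℝ → X := fun t => zeroExtend N v ⌈t / (T / N)⌉ -
    zeroExtend L (gridAverage N L v) ⌈t / (T / L)⌉
  have hm1 := aestronglyMeasurable_comp_ceil (zeroExtend N v) (T / N) volume
  have hm2 := aestronglyMeasurable_comp_ceil (zeroExtend L (gridAverage N L v)) (T / L) volume
  have hdm : AEStronglyMeasurable dX volume := hm1.sub hm2
  have hdX : eLpNorm dX p volume ≤ ENNReal.ofReal (3 * C) := by
    refine (eLpNorm_sub_le hm1 hm2 hp).trans ((add_le_add hv
      ((eLpNorm_gridAverage_le hp hT (by omega) (by omega) v).trans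
        (mul_le_mul_right hv 2))).trans (le_of_eq ?_))
    rw [ENNReal.ofReal_mul (by norm_num), show ENNReal.ofReal 3 = 3 by norm_num]
    ring
  have hdY : eLpNorm (fun t => iBY (iXB (dX t))) p volume ≤
      ENNReal.ofReal (4 * (3 * (2 * T / (L : ℝ)) ^ α / (Real.Gamma α * α) * C)) := by
    have h := eLpNorm_sub_gridAverage_le_of_discreteCaputo hp hα0 hα1 hT hL2 hLN y
      (fun k => iBY (iXB (v k)))
    have hfun : (fun t => iBY (iXB (dX t))) = fun t : ℝ =>
        zeroExtend N (fun k => iBY (iXB (v k))) ⌈t / (T / N)⌉ -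
        zeroExtend L (gridAverage N L fun k => iBY (iXB (v k))) ⌈t / (T / L)⌉ := by
      ext t
      simp only [dX, map_sub]
      have e := fun k => (iBY.comp iXB).map_gridAverage N L v k
      simp only [ContinuousLinearMap.comp_apply] at e
      have e1 := map_zeroExtend (iBY.comp iXB) N v
      have e2 := map_zeroExtend (iBY.comp iXB) L (gridAverage N L v)
      simp only [ContinuousLinearMap.comp_apply, e] at e1 e2
      rw [e1, e2]
    rw [hfun]
    refine h.trans ?_
    rw [ENNReal.ofReal_mul (by norm_num), ENNReal.ofReal_mul (by positivity),
      show ENNReal.ofReal 4 = 4 by norm_num]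
    gcongr
  have hfunB : (fun t : ℝ => zeroExtend N (fun k => iXB (v k)) ⌈t / (T / N)⌉ -
      zeroExtend L (fun k => iXB (gridAverage N L v k)) ⌈t / (T / L)⌉) =
      fun t => iXB (dX t) := by
    ext t
    simp only [dX, map_sub, map_zeroExtend]
  rw [hfunB]
  have hYm : AEStronglyMeasurable (fun t => iBY (iXB (dX t))) volume :=
    (iBY.comp iXB).continuous.comp_aestronglyMeasurable hdm
  calc eLpNorm (fun t => iXB (dX t)) p volume
      ≤ eLpNorm ((η • fun t => ‖dX t‖) + A • fun t => ‖iBY (iXB (dX t))‖) p volume :=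
        eLpNorm_mono_real fun t => hA (dX t)
    _ ≤ ENNReal.ofReal η * eLpNorm dX p volume +
          ENNReal.ofReal A * eLpNorm (fun t => iBY (iXB (dX t))) p volume := by
        refine (eLpNorm_add_le (hdm.norm.const_smul η) (hYm.norm.const_smul A) hp).trans
          (le_of_eq ?_)
        rw [eLpNorm_const_smul, eLpNorm_const_smul, eLpNorm_norm, eLpNorm_norm,
          Real.enorm_of_nonneg hη0.le, Real.enorm_of_nonneg hA0]
    _ ≤ ENNReal.ofReal η * ENNReal.ofReal (3 * C) + ENNReal.ofReal A *
          ENNReal.ofReal (4 * (3 * (2 * T / (L : ℝ)) ^ α / (Real.Gamma α * α) * C)) := by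
        gcongr
    _ = ENNReal.ofReal (η * (3 * C) +
          A * (4 * (3 * (2 * T / (L : ℝ)) ^ α / (Real.Gamma α * α) * C))) := by
        rw [← ENNReal.ofReal_mul hη0.le, ← ENNReal.ofReal_mul hA0,
          ENNReal.ofReal_add (by positivity) (by positivity)]
    _ < ENNReal.ofReal ε := by
        rw [ENNReal.ofReal_lt_ofReal_iff hε]
        linarith

/-! ### Total boundedness and conclusion. -/

theorem totallyBounded_of_forall_exists_dist_lt {M : Type*} [PseudoMetricSpace M] {s : Set M}
    (h : ∀ ε > 0, ∃ t : Set M, TotallyBounded t ∧ ∀ x ∈ s, ∃ y ∈ t, dist x y < ε) :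
    TotallyBounded s := by
  rw [Metric.totallyBounded_iff]
  intro ε hε
  obtain ⟨t, ht, hst⟩ := h (ε / 2) (half_pos hε)
  obtain ⟨u, hu, htu⟩ := Metric.totallyBounded_iff.1 ht (ε / 2) (half_pos hε)
  refine ⟨u, hu, fun x hx => ?_⟩
  obtain ⟨y, hy, hxy⟩ := hst x hx
  obtain ⟨z, hz, hyz⟩ := mem_iUnion₂.1 (htu hy)
  refine mem_iUnion₂.2 ⟨z, hz, ?_⟩
  rw [Metric.mem_ball] at hyz ⊢
  linarith [dist_triangle x y z]

theorem theorem2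
    {X B Y : Type*}
    [NormedAddCommGroup X] [NormedSpace ℝ X] [CompleteSpace X]
    [NormedAddCommGroup B] [NormedSpace ℝ B] [CompleteSpace B]
    [NormedAddCommGroup Y] [NormedSpace ℝ Y] [CompleteSpace Y]
    -- the compact embedding of `X` in `B` and the continuous embedding of `B` in `Y`
    (iXB : X →L[ℝ] B) (hXB_inj : Function.Injective iXB) (hXB : IsCompactOperator iXB)
    (iBY : B →L[ℝ] Y) (hBY_inj : Function.Injective iBY)
    (p : ℝ≥0∞) [Fact (1 ≤ p)]
    (α : ℝ) (hα0 : 0 < α) (hα1 : α < 1)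
    (T : ℝ) (hT : 0 < T)
    -- a family of piecewise constant functions, the `m`-th one with time step `T / N m`,
    -- initial value `f₀ m` and value `f m k` on the `k`-th time interval, `1 ≤ k ≤ N m`
    {ι : Type*} (N : ι → ℕ) (hN : ∀ m, 1 ≤ N m) (f₀ : ι → Y) (f : ι → ℕ → X)
    (C₀ : ℝ)
    (hbound : ∀ m,
      eLpNorm (stepFun (T / N m) (N m) (f m)) p (volume.restrict (Ioo 0 T)) +
        eLpNorm (stepFun (T / N m) (N m)
          (discreteCaputo α (T / N m) (withInitial (f₀ m) fun k => iBY (iXB (f m k)))))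
          p (volume.restrict (Ioo 0 T)) ≤ ENNReal.ofReal C₀) :
    ∃ hmem : ∀ m, MemLp (stepFun (T / N m) (N m) fun k => iXB (f m k)) p
        (volume.restrict (Ioo 0 T)),
      IsCompact (closure (range fun m => (hmem m).toLp
        (stepFun (T / N m) (N m) fun k => iXB (f m k)))) := by
  have hp : 1 ≤ p := Fact.out
  refine ⟨fun m => memLp_stepFun _ _ _ p T, TotallyBounded.isCompact_of_isClosed
    (TotallyBounded.closure ?_) isClosed_closure⟩
  set C := max C₀ 0
  have hC : 0 ≤ C := le_max_right _ _
  have hCle : ENNReal.ofReal C₀ ≤ ENNReal.ofReal C := ENNReal.ofReal_le_ofReal (le_max_left _ _)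
  have hf : ∀ m, eLpNorm (fun t : ℝ => zeroExtend (N m) (f m) ⌈t / (T / N m)⌉) p volume ≤
      ENNReal.ofReal C := fun m => by
    rw [← eLpNorm_stepFun hT (hN m)]
    exact (le_self_add.trans (hbound m)).trans hCle
  have hD : ∀ m, eLpNorm (fun t : ℝ => zeroExtend (N m) (discreteCaputo α (T / N m)
      (withInitial (f₀ m) fun k => iBY (iXB (f m k)))) ⌈t / (T / N m)⌉) p volume ≤
      ENNReal.ofReal C := fun m => by
    rw [← eLpNorm_stepFun hT (hN m)]
    exact (le_add_self.trans (hbound m)).trans hCle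
  -- the step functions on a fixed grid that satisfy the bound form a totally bounded set
  have hgrid : ∀ n : ℕ, 1 ≤ n → TotallyBounded {F : Lp B p (volume.restrict (Ioo 0 T)) |
      ∃ v : ℕ → X, eLpNorm (fun t : ℝ => zeroExtend n v ⌈t / (T / n)⌉) p volume ≤
        ENNReal.ofReal (2 * C) ∧ F = (memLp_stepFun (T / n) n (fun k => iXB (v k)) p T).toLp
          (stepFun (T / n) n fun k => iXB (v k))} := by
    intro n hn
    have hn' : (0 : ℝ) < n := by exact_mod_cast hn
    have hτ : 0 < T / n := by positivity
    obtain ⟨R, hR⟩ := exists_norm_le_of_eLpNorm_zeroExtend_le (X := X) hp hτ n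
      (mul_nonneg zero_le_two hC)
    refine (isCompact_image_toLp_stepFun p (T / n) T n
      (hXB.isCompact_closure_image_closedBall (max R 0))).totallyBounded.subset ?_
    rintro F ⟨v, hv, rfl⟩
    -- Only the values at `1, …, n` are bounded; the others do not affect the step function and are
    -- reset to 0 to stay in the compact set.
    refine ⟨fun k => if k ∈ Finset.Icc 1 n then iXB (v k) else 0, fun k _ => subset_closure ?_, ?_⟩
    · simp only
      split_ifs with hk
      · rw [Finset.mem_Icc] at hk
        exact mem_image_of_mem _ (mem_closedBall_zero_iff.2
          ((hR v hv k hk.1 hk.2).trans (le_max_left _ _)))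
      · exact ⟨0, by simp, map_zero _⟩
    · simp only
      congr 1
      ext t
      exact Finset.sum_congr rfl fun k hk => by simp only [if_pos hk]
  refine totallyBounded_of_forall_exists_dist_lt fun ε hε => ?_
  obtain ⟨L, hL1, hL⟩ := exists_gridAverage_approx hXB hBY_inj hp hα0 hα1 hT hC hε
  refine ⟨_, (totallyBounded_biUnion (Set.finite_Icc 1 L)).2 fun n hn => hgrid n hn.1, ?_⟩
  rintro _ ⟨m, rfl⟩
  -- A grid with at most `L` cells is one of finitely many, so the function is its own approximant;
  -- otherwise the average over `L` blocks serves, and its norm bound is the reason for `2 * C` in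
  -- `hgrid`.
  rcases le_total (N m) L with hle | hle
  · refine ⟨_, mem_iUnion₂.2 ⟨N m, ⟨hN m, hle⟩, f m, (hf m).trans
      (ENNReal.ofReal_le_ofReal (by linarith)), rfl⟩, ?_⟩
    rwa [dist_self]
  · refine ⟨_, mem_iUnion₂.2 ⟨L, ⟨hL1, le_rfl⟩, gridAverage (N m) L (f m), ?_, rfl⟩, ?_⟩
    · refine (eLpNorm_gridAverage_le hp hT (hN m) hL1 (f m)).trans ?_
      rw [ENNReal.ofReal_mul zero_le_two, show ENNReal.ofReal 2 = 2 by norm_num]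
      exact mul_le_mul_right (hf m) 2
    · rw [← edist_lt_ofReal, Lp.edist_toLp_toLp]
      refine lt_of_le_of_lt (eLpNorm_restrict_le _ p volume _) ?_
      have hN' : (0 : ℝ) < N m := by exact_mod_cast hN m
      have hL' : (0 : ℝ) < L := by exact_mod_cast hL1
      refine lt_of_le_of_lt (le_of_eq ?_) (hL (N m) hle (f₀ m) (f m) (hf m) (hD m))
      congr 1
      ext t
      rw [Pi.sub_apply, stepFun_eq (by positivity), stepFun_eq (by positivity)]
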